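/- Let $X$ be a (real) vector lattice equipped with a Hausdorff locally solid topology $\tau$, i.e. a Hausdorff linear topology with a local basis at zero consisting of solid sets ($S$ is solid if $|x|\le|y|$, $y\in S$ imply $x\in S$). Let $X'$ be its topological dual, and let $|\sigma|(X,X')$ be the absolute weak topology, i.e. the linear topology generated by the seminorms $x\mapsto |f|(|x|)$, $f\in X'$, where $|f|(u)=\sup\{f(y): y \in X,\ |y|\le u\}$ for $u\in X_+$. Assume that $X$ is $\sigma$-order complete, i.e. every non-empty countable subset of $X$ that is bounded above has a supremum. Suppose that $X$ has the unbounded Banach–Saks property: every $\tau$-bounded sequence $(x_n)\subseteq X$ such that $|x_n|\wedge u\to 0$ in $|\sigma|(X,X')$ for each $u\in X_+$ has a subsequence $(x_{n_k})$ whose Cesàro means $\frac1n\sum_{k=1}^n x_{n_k}$ are $\tau$-convergent in $X$. Then $X$ has the disjoint Banach–Saks property: every $\tau$-bounded disjoint sequence $(x_n)\subseteq X$ (that is, $|x_n|\wedge|x_m|=0$ for $n\ne m$) has a subsequence $(x_{n_k})$ whose Cesàro means $\frac1n\sum_{k=1}^n x_{n_k}$ are $\tau$-convergent in $X$. -/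

import Mathlib

open Filter Topology

/-- `σ`-order completeness: every nonempty countable subset that is bounded above has a supremum. -/
def SigmaOrderComplete (X : Type*) [PartialOrder X] : Prop :=
  ∀ s : Set X, s.Nonempty → s.Countable → BddAbove s → ∃ a, IsLUB s a

/-- The topology of `X` has a basis at zero consisting of solid sets. Together with
`IsTopologicalAddGroup X` and `ContinuousSMul ℝ X` (a linear topology) this says that the topology
is locally solid. -/
class HasSolidBasis (X : Type*) [AddCommGroup X] [Lattice X] [TopologicalSpace X] : Prop where
  hasBasis_nhds_zero :
    (𝓝 (0 : X)).HasBasis (fun s => s ∈ 𝓝 (0 : X) ∧ LatticeOrderedAddCommGroup.IsSolid s) id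

section AbsoluteWeak

variable {X : Type*} [AddCommGroup X] [Lattice X] [Module ℝ X] [IsOrderedModule ℝ X]

theorem abs_smul_le_smul_abs (r : ℝ) (x : X) : |r • x| ≤ |r| • |x| := by
  have key : ∀ (s : ℝ) (y : X), s • y ≤ |s| • |y| := by
    intro s y
    rcases le_total 0 s with hs | hs
    · rw [abs_of_nonneg hs]
      exact smul_le_smul_of_nonneg_left (le_abs_self y) hs
    · rw [abs_of_nonpos hs, ← neg_smul_neg]
      exact smul_le_smul_of_nonneg_left (neg_le_abs y) (neg_nonneg.2 hs)
  refine abs_le'.2 ⟨key r x, ?_⟩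
  have h := key (-r) x
  rwa [abs_neg, neg_smul] at h

variable [TopologicalSpace X]

/-- The value at `u ≥ 0` of the modulus `|f|` of a functional `f ∈ X'`, the modulus being taken in
the order dual of `X`, by the Riesz–Kantorovich formula `|f|(u) = sup {f y : |y| ≤ u}`. -/
noncomputable def dualModulus (f : X →L[ℝ] ℝ) (u : X) : ℝ :=
  sSup (f '' {y : X | |y| ≤ u})

theorem bddAbove_image_order_interval [ContinuousSMul ℝ X] [HasSolidBasis X]
    (f : X →L[ℝ] ℝ) (u : X) : BddAbove (f '' {y : X | |y| ≤ u}) := by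
  have hf : f ⁻¹' Metric.ball 0 1 ∈ 𝓝 (0 : X) := by
    apply f.continuous.continuousAt.preimage_mem_nhds
    rw [map_zero]
    exact Metric.ball_mem_nhds 0 one_pos
  obtain ⟨V, ⟨hV, hsol⟩, hVf⟩ := (HasSolidBasis.hasBasis_nhds_zero (X := X)).mem_iff.1 hf
  have ht : Tendsto (fun r : ℝ => r • u) (𝓝[>] 0) (𝓝 (0 : X)) := by
    have h : Continuous (fun r : ℝ => r • u) := continuous_id.smul continuous_const
    have h0 := h.tendsto 0
    simp only [zero_smul] at h0
    exact h0.mono_left nhdsWithin_le_nhds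
  obtain ⟨r, hrV, hr⟩ := ((ht.eventually hV).and self_mem_nhdsWithin).exists
  have hr : 0 < r := hr
  refine ⟨r⁻¹, ?_⟩
  rintro _ ⟨y, hy, rfl⟩
  have hy : |y| ≤ u := hy
  have hmem : r • y ∈ V := by
    refine hsol hrV ?_
    calc |r • y| ≤ |r| • |y| := abs_smul_le_smul_abs r y
      _ = r • |y| := by rw [abs_of_pos hr]
      _ ≤ r • u := smul_le_smul_of_nonneg_left hy hr.le
      _ ≤ |r • u| := le_abs_self _
  have h1 : f (r • y) ∈ Metric.ball (0 : ℝ) 1 := hVf hmem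
  rw [mem_ball_zero_iff, map_smul, smul_eq_mul, Real.norm_eq_abs] at h1
  have h2 : r * f y < 1 := lt_of_abs_lt h1
  rw [inv_eq_one_div, le_div_iff₀ hr]
  linarith

variable [IsOrderedAddMonoid X] [ContinuousSMul ℝ X] [HasSolidBasis X]

theorem dualModulus_add_le (f : X →L[ℝ] ℝ) (x y : X) :
    dualModulus f |x + y| ≤ dualModulus f |x| + dualModulus f |y| := by
  refine csSup_le ⟨f 0, 0, by simp, rfl⟩ ?_
  rintro _ ⟨z, hz, rfl⟩
  have hz : |z| ≤ |x| + |y| := le_trans hz (abs_add_le x y)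
  have hzu : z ≤ |x| + |y| := (le_abs_self z).trans hz
  have hzl : -z ≤ |x| + |y| := (neg_le_abs z).trans hz
  have hx : 0 ≤ |x| := abs_nonneg x
  have hy : 0 ≤ |y| := abs_nonneg y
  obtain ⟨w, hw⟩ : ∃ w, w = (z ⊓ |x|) ⊔ -|x| := ⟨_, rfl⟩
  have hw1 : |w| ≤ |x| := by
    refine abs_le'.2 ⟨?_, ?_⟩
    · rw [hw]
      exact sup_le inf_le_right ((neg_nonpos.2 hx).trans hx)
    · rw [neg_le, hw]
      exact le_sup_right
  have hw2 : |z - w| ≤ |y| := by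
    refine abs_le'.2 ⟨?_, ?_⟩
    · have h : z - |y| ≤ w := by
        rw [hw]
        refine le_trans (le_inf ?_ ?_) le_sup_left
        · exact sub_le_self z hy
        · exact sub_le_iff_le_add.2 hzu
      exact sub_le_comm.1 h
    · rw [neg_sub, sub_le_iff_le_add, hw]
      refine sup_le (inf_le_left.trans (le_add_of_nonneg_left hy)) ?_
      have h : 0 ≤ z + (|x| + |y|) := neg_le_iff_add_nonneg'.1 hzl
      rw [neg_le_iff_add_nonneg]
      refine h.trans_eq ?_
      abel
  have hsplit : f z = f w + f (z - w) := by rw [← map_add, add_sub_cancel]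
  rw [hsplit]
  exact add_le_add (le_csSup (bddAbove_image_order_interval f |x|) ⟨w, hw1, rfl⟩)
    (le_csSup (bddAbove_image_order_interval f |y|) ⟨z - w, hw2, rfl⟩)

theorem dualModulus_smul_le (f : X →L[ℝ] ℝ) (r : ℝ) (x : X) :
    dualModulus f |r • x| ≤ ‖r‖ * dualModulus f |x| := by
  refine csSup_le ⟨f 0, 0, by simp, rfl⟩ ?_
  rintro _ ⟨z, hz, rfl⟩
  have hz : |z| ≤ |r| • |x| := le_trans hz (abs_smul_le_smul_abs r x)
  rcases eq_or_ne r 0 with rfl | hr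
  · rw [abs_zero, zero_smul] at hz
    have h1 : z ≤ 0 := (le_abs_self z).trans hz
    have h2 : -z ≤ 0 := (neg_le_abs z).trans hz
    have h3 : z = 0 := le_antisymm h1 (neg_nonpos.1 h2)
    simp [h3]
  · have hpos : 0 < |r| := abs_pos.2 hr
    have hmem : |(|r|⁻¹ • z)| ≤ |x| := by
      calc |(|r|⁻¹ • z)| ≤ |(|r|⁻¹)| • |z| := abs_smul_le_smul_abs _ _
        _ = |r|⁻¹ • |z| := by rw [abs_of_pos (inv_pos.2 hpos)]
        _ ≤ |r|⁻¹ • (|r| • |x|) := smul_le_smul_of_nonneg_left hz (inv_pos.2 hpos).le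
        _ = |x| := inv_smul_smul₀ hpos.ne' _
    have h := le_csSup (bddAbove_image_order_interval f |x|) ⟨_, hmem, rfl⟩
    have hfz : f z = |r| * f (|r|⁻¹ • z) := by
      rw [map_smul, smul_eq_mul, mul_inv_cancel_left₀ hpos.ne']
    rw [hfz, Real.norm_eq_abs]
    exact mul_le_mul_of_nonneg_left h hpos.le

/-- The lattice seminorm `x ↦ |f|(|x|)` attached to `f ∈ X'`. -/
noncomputable def absWeakSeminorm (f : X →L[ℝ] ℝ) : Seminorm ℝ X :=
  Seminorm.ofSMulLE (fun x => dualModulus f |x|)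
    (le_antisymm (by simpa using dualModulus_smul_le f 0 (0 : X))
      (le_csSup (bddAbove_image_order_interval f _) ⟨0, by simp, map_zero f⟩))
    (dualModulus_add_le f) (dualModulus_smul_le f)

/-- The absolute weak topology `|σ|(X, X')`: the linear topology on `X` generated by the seminorms
`x ↦ |f|(|x|)`, where `f` runs through the topological dual `X'` of `X`. -/
@[reducible]
noncomputable def absWeakTopology (X : Type*) [AddCommGroup X] [Lattice X] [Module ℝ X]
    [IsOrderedModule ℝ X] [IsOrderedAddMonoid X] [TopologicalSpace X] [ContinuousSMul ℝ X]
    [HasSolidBasis X] : TopologicalSpace X :=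
  (SeminormFamily.moduleFilterBasis (𝕜 := ℝ)
    (fun f : X →L[ℝ] ℝ => absWeakSeminorm f)).topology

end AbsoluteWeak

section BanachSaks

variable {X : Type*} [AddCommGroup X] [Lattice X]

/-- `x n → a` in the unbounded modification of the topology `t`: for every `u ≥ 0`,
`|x n - a| ⊓ u → 0` with respect to `t`. -/
def UnboundedTendsto (t : TopologicalSpace X) (x : ℕ → X) (a : X) : Prop :=
  ∀ u : X, 0 ≤ u → Tendsto (fun n => |x n - a| ⊓ u) atTop (@nhds X t 0)

/-- The terms of the sequence are pairwise disjoint: `|x m| ⊓ |x n| = 0` for `m ≠ n`. -/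
def DisjointSeq (x : ℕ → X) : Prop :=
  Pairwise fun m n => |x m| ⊓ |x n| = 0

variable [Module ℝ X] [TopologicalSpace X]

/-- Some subsequence of `x` has convergent Cesàro means. -/
def HasCesaroConvergentSubseq (x : ℕ → X) : Prop :=
  ∃ φ : ℕ → ℕ, StrictMono φ ∧ ∃ a : X,
    Tendsto (fun n : ℕ => (n : ℝ)⁻¹ • ∑ k ∈ Finset.range n, x (φ k)) atTop (𝓝 a)

variable (X)

/-- The unbounded Banach–Saks property: every topologically bounded sequence which is null in the
unbounded absolute weak topology has a subsequence with convergent Cesàro means. -/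
def UnboundedBanachSaks [IsOrderedAddMonoid X] [IsOrderedModule ℝ X] [ContinuousSMul ℝ X]
    [HasSolidBasis X] : Prop :=
  ∀ x : ℕ → X, Bornology.IsVonNBounded ℝ (Set.range x) →
    UnboundedTendsto (absWeakTopology X) x 0 → HasCesaroConvergentSubseq x

/-- The disjoint Banach–Saks property: every topologically bounded disjoint sequence has a
subsequence with convergent Cesàro means. -/
def DisjointBanachSaks : Prop :=
  ∀ x : ℕ → X, Bornology.IsVonNBounded ℝ (Set.range x) →
    DisjointSeq x → HasCesaroConvergentSubseq x

end BanachSaks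

section LatticeOrderedGroup

variable {X : Type*} [AddCommGroup X] [Lattice X] [IsOrderedAddMonoid X]

theorem add_inf_eq_zero_of_nonneg {a b c : X} (ha : 0 ≤ a) (hb : 0 ≤ b) (hc : 0 ≤ c)
    (hac : a ⊓ c = 0) (hbc : b ⊓ c = 0) : (a + b) ⊓ c = 0 := by
  refine le_antisymm ?_ (le_inf (add_nonneg ha hb) hc)
  rw [← hbc]
  refine le_inf ?_ inf_le_right
  have h : (a + b) ⊓ c ≤ (a + b) ⊓ (c + b) := inf_le_inf_left _ (le_add_of_nonneg_right hb)
  rwa [← inf_add, hac, zero_add] at h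

theorem sum_inf_eq_zero_of_nonneg {ι : Type*} (s : Finset ι) {y : ι → X} {c : X}
    (hy : ∀ i, 0 ≤ y i) (hc : 0 ≤ c) (h : ∀ i ∈ s, y i ⊓ c = 0) : (∑ i ∈ s, y i) ⊓ c = 0 := by
  classical
  induction s using Finset.induction_on with
  | empty => simpa using hc
  | insert i s hi ih =>
    rw [Finset.sum_insert hi]
    exact add_inf_eq_zero_of_nonneg (hy i) (Finset.sum_nonneg fun j _ => hy j) hc
      (h i (Finset.mem_insert_self i s)) (ih fun j hj => h j (Finset.mem_insert_of_mem hj))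

/-- A finite sum of pairwise disjoint positive elements is below every common upper bound. -/
theorem sum_range_le_of_pairwise_disjoint {y : ℕ → X} {u : X} (hy : ∀ n, 0 ≤ y n)
    (hyu : ∀ n, y n ≤ u) (hd : Pairwise fun m n => y m ⊓ y n = 0) (n : ℕ) :
    ∑ k ∈ Finset.range n, y k ≤ u := by
  induction n with
  | zero => simpa using (hy 0).trans (hyu 0)
  | succ n ih =>
    have h0 : (∑ k ∈ Finset.range n, y k) ⊓ y n = 0 :=
      sum_inf_eq_zero_of_nonneg _ hy (hy n) fun k hk => hd (Finset.mem_range.1 hk).ne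
    rw [Finset.sum_range_succ, ← inf_add_sup, h0, zero_add]
    exact sup_le ih (hyu n)

theorem DisjointSeq.pairwise_inf {x : ℕ → X} (hx : DisjointSeq x) {u : X} (hu : 0 ≤ u) :
    Pairwise fun m n => (|x m| ⊓ u) ⊓ (|x n| ⊓ u) = 0 := fun _ _ hmn =>
  le_antisymm ((inf_le_inf inf_le_left inf_le_left).trans (hx hmn).le)
    (le_inf (le_inf (abs_nonneg _) hu) (le_inf (abs_nonneg _) hu))

end LatticeOrderedGroup

section DualModulus

variable {X : Type*} [AddCommGroup X] [Lattice X] [IsOrderedAddMonoid X] [Module ℝ X]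
  [IsOrderedModule ℝ X] [TopologicalSpace X] [ContinuousSMul ℝ X] [HasSolidBasis X]

theorem dualModulus_nonneg (f : X →L[ℝ] ℝ) {u : X} (hu : 0 ≤ u) : 0 ≤ dualModulus f u :=
  le_csSup (bddAbove_image_order_interval f u) ⟨0, by simpa using hu, map_zero f⟩

theorem dualModulus_mono (f : X →L[ℝ] ℝ) {u v : X} (hu : 0 ≤ u) (huv : u ≤ v) :
    dualModulus f u ≤ dualModulus f v :=
  csSup_le_csSup (bddAbove_image_order_interval f v) ⟨f 0, 0, by simpa using hu, rfl⟩
    (Set.image_mono fun _ hy => le_trans hy huv)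

theorem add_dualModulus_le (f : X →L[ℝ] ℝ) {u v : X} (hu : 0 ≤ u) (hv : 0 ≤ v) :
    dualModulus f u + dualModulus f v ≤ dualModulus f (u + v) := by
  rw [← le_sub_iff_add_le]
  refine csSup_le ⟨f 0, 0, by simpa using hu, rfl⟩ ?_
  rintro _ ⟨y, hy, rfl⟩
  rw [le_sub_comm]
  refine csSup_le ⟨f 0, 0, by simpa using hv, rfl⟩ ?_
  rintro _ ⟨z, hz, rfl⟩
  rw [le_sub_iff_add_le', ← map_add]
  exact le_csSup (bddAbove_image_order_interval f _)
    ⟨y + z, (abs_add_le y z).trans (add_le_add hy hz), rfl⟩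

theorem sum_range_dualModulus_le (f : X →L[ℝ] ℝ) {y : ℕ → X} (hy : ∀ n, 0 ≤ y n) (n : ℕ) :
    ∑ k ∈ Finset.range n, dualModulus f (y k) ≤ dualModulus f (∑ k ∈ Finset.range n, y k) := by
  induction n with
  | zero => simpa using dualModulus_nonneg f (le_refl (0 : X))
  | succ n ih =>
    rw [Finset.sum_range_succ, Finset.sum_range_succ]
    exact (add_le_add_left ih _).trans
      (add_dualModulus_le f (Finset.sum_nonneg fun k _ => hy k) (hy n))

/-- The modulus of a functional tends to zero along an order bounded disjoint positive sequence. -/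
theorem tendsto_dualModulus_of_pairwise_disjoint (f : X →L[ℝ] ℝ) {y : ℕ → X} {u : X}
    (hy : ∀ n, 0 ≤ y n) (hyu : ∀ n, y n ≤ u) (hd : Pairwise fun m n => y m ⊓ y n = 0) :
    Tendsto (fun n => dualModulus f (y n)) atTop (𝓝 0) :=
  (summable_of_sum_range_le (fun n => dualModulus_nonneg f (hy n)) fun n =>
    (sum_range_dualModulus_le f hy n).trans
      (dualModulus_mono f (Finset.sum_nonneg fun k _ => hy k)
        (sum_range_le_of_pairwise_disjoint hy hyu hd n))).tendsto_atTop_zero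

theorem tendsto_absWeakTopology_zero {x : ℕ → X}
    (hx : ∀ f : X →L[ℝ] ℝ, Tendsto (fun n => dualModulus f |x n|) atTop (𝓝 0)) :
    Tendsto x atTop (@nhds X (absWeakTopology X) 0) := by
  have hp := @WithSeminorms.mk ℝ X (X →L[ℝ] ℝ) _ _ _
    (fun f : X →L[ℝ] ℝ => absWeakSeminorm f) (absWeakTopology X) rfl
  refine (@WithSeminorms.tendsto_nhds ℝ X ℕ (X →L[ℝ] ℝ) _ _ _ (absWeakTopology X) _ hp x
    atTop 0).2 fun f ε hε => ?_
  filter_upwards [(hx f).eventually_lt_const hε] with n hn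
  rwa [sub_zero]

/-- Every disjoint sequence is null in the unbounded absolute weak topology. -/
theorem DisjointSeq.unboundedTendsto_absWeakTopology {x : ℕ → X} (hx : DisjointSeq x) :
    UnboundedTendsto (absWeakTopology X) x 0 := by
  intro u hu
  have hy : ∀ n, 0 ≤ |x n| ⊓ u := fun n => le_inf (abs_nonneg _) hu
  refine tendsto_absWeakTopology_zero fun f => ?_
  simp only [sub_zero, abs_of_nonneg (hy _)]
  exact tendsto_dualModulus_of_pairwise_disjoint f hy (fun n => inf_le_right) (hx.pairwise_inf hu)

end DualModulus

theorem proposition2p4 {X : Type*} [AddCommGroup X] [Lattice X] [IsOrderedAddMonoid X]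
    [Module ℝ X] [IsOrderedModule ℝ X]
    [TopologicalSpace X] [IsTopologicalAddGroup X] [ContinuousSMul ℝ X] [HasSolidBasis X]
    [T2Space X] (hX : SigmaOrderComplete X) (h : UnboundedBanachSaks X) :
    DisjointBanachSaks X :=
  fun x hb hd => h x hb hd.unboundedTendsto_absWeakTopology
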